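/- Let $E\subseteq\mathbb R$ and let $(Y_n)_{n\ge 0}$ be a time-homogeneous Markov process with values in $E$ with respect to a filtration $(\mathcal A_n)_{n\ge 0}$, with starting point $y$ under the probability measure $P_y$ ($y\in E$); $E_y$ is the expectation under $P_y$. Let $0<\rho\le 1$ and let $g:E\to[0,\infty)$ be measurable. With the convention $\rho^\infty=0$ (also for $\rho=1$) and $\rho^\tau g(Y_\tau)=0$ on $\{\tau=\infty\}$, put $$V(y)=\sup_\tau E_y\,\rho^\tau g(Y_\tau),\qquad y\in E,$$ the supremum being over all $(\mathcal A_n)$-stopping times $\tau$ with values in $\{0,1,2,\dots\}\cup\{\infty\}$. A stopping time $\tau$ is called optimal if $E_y\,\rho^\tau g(Y_\tau)=V(y)$ for all $y\in E$. For $y\in E$ let $$\tau_y=\inf\{n>0:Y_n>y\},\qquad \phi(y)=E_y\,\rho^{\tau_y}g(Y_{\tau_y}),\qquad f(y)=\frac{g(y)-\phi(y)}{1-E_y\,\rho^{\tau_y}},$$ where $\inf\emptyset=\infty$, and let $\alpha^*=\inf\{z\in E:g(z)\ge\phi(z)\}\in[-\infty,\infty]$. Assume that for every $y\in E$ $$E_y\sup_{n\ge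 0}\rho^n g(Y_n)<\infty\quad\text{and}\quad \rho^n g(Y_n)\to 0\ \ P_y\text{-almost surely as } n\to\infty,$$ and, if $\rho=1$, that $P_y(\tau_y=\infty)>0$ for every $y\in E$. Assume further that $f$ is increasing (not necessarily strictly) on $E\cap[\alpha^*,\infty)$. Then: (i) If $f(\alpha^*)\ge 0$, then $\tau^*=\inf\{n\ge 0:Y_n\ge\alpha^*\}$ is an optimal stopping time, and $\{y\in E:V(y)=g(y)\}=E\cap[\alpha^*,\infty)$. (ii) If $f(\alpha^*)\le 0$, then $\tau^*=\inf\{n\ge 0:Y_n>\alpha^*\}$ is an optimal stopping time. Here the condition on $f(\alpha^*)$ in (i) and in (ii) is only required when $\alpha^*\in E$; if $\alpha^*\notin E$, both conclusions hold without it. -/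

import Mathlib

open MeasureTheory ProbabilityTheory Filter Topology
open scoped NNReal ENNReal

noncomputable section

namespace OneSidedStopping

variable {Ω : Type*} {mΩ : MeasurableSpace Ω} {E : Set ℝ}

/-- `Y` is a time-homogeneous Markov process with values in the state space `E ⊆ ℝ` and transition
kernel `κ`, with respect to the filtration `𝒜`; under the probability measure `P y` it starts
at `y`. -/
structure IsMarkovFamily (κ : Kernel E E) (𝒜 : Filtration ℕ mΩ) (Y : ℕ → Ω → E)
    (P : E → Measure Ω) : Prop where
  isProbabilityMeasure : ∀ y, IsProbabilityMeasure (P y)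
  adapted : ∀ n, Measurable[𝒜 n] (Y n)
  start : ∀ y, ∀ᵐ ω ∂(P y), Y 0 ω = y
  markov : ∀ (y : E) (n : ℕ) (B : Set E), MeasurableSet B →
    (P y)⟦Y (n + 1) ⁻¹' B | 𝒜 n⟧ =ᵐ[P y] fun ω => (κ (Y n ω)).real B

/-- The discount factor `ρ ^ t` for a possibly infinite time `t`, with `ρ ^ ∞ = 0` (also for
`ρ = 1`). -/
def discount (ρ : ℝ≥0) : WithTop ℕ → ℝ≥0∞
  | ⊤ => 0
  | (n : ℕ) => (ρ : ℝ≥0∞) ^ n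

/-- The discounted reward `ρ ^ τ * g (Y_τ)`, equal to `0` on `{τ = ∞}`. -/
def reward (ρ : ℝ≥0) (g : E → ℝ≥0) (Y : ℕ → Ω → E) (τ : Ω → WithTop ℕ) (ω : Ω) : ℝ≥0∞ :=
  match τ ω with
  | ⊤ => 0
  | (n : ℕ) => (ρ : ℝ≥0∞) ^ n * (g (Y n ω) : ℝ≥0∞)

/-- `E_y ρ ^ τ`. -/
def expDiscount (P : E → Measure Ω) (ρ : ℝ≥0) (τ : Ω → WithTop ℕ) (y : E) : ℝ≥0∞ :=
  ∫⁻ ω, discount ρ (τ ω) ∂(P y)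

/-- `E_y ρ ^ τ g(Y_τ)`. -/
def expReward (P : E → Measure Ω) (ρ : ℝ≥0) (g : E → ℝ≥0) (Y : ℕ → Ω → E)
    (τ : Ω → WithTop ℕ) (y : E) : ℝ≥0∞ :=
  ∫⁻ ω, reward ρ g Y τ ω ∂(P y)

/-- The value function `V(y) = sup_τ E_y ρ ^ τ g(Y_τ)` over all stopping times `τ`
(which may take the value `∞`). -/
def value (𝒜 : Filtration ℕ mΩ) (P : E → Measure Ω) (ρ : ℝ≥0) (g : E → ℝ≥0)
    (Y : ℕ → Ω → E) (y : E) : ℝ≥0∞ :=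
  ⨆ (τ : Ω → WithTop ℕ) (_ : IsStoppingTime 𝒜 τ), expReward P ρ g Y τ y

/-- `τ` is an optimal stopping time, for every starting point. -/
def IsOptimal (𝒜 : Filtration ℕ mΩ) (P : E → Measure Ω) (ρ : ℝ≥0) (g : E → ℝ≥0)
    (Y : ℕ → Ω → E) (τ : Ω → WithTop ℕ) : Prop :=
  IsStoppingTime 𝒜 τ ∧ ∀ y, expReward P ρ g Y τ y = value 𝒜 P ρ g Y y

/-- The stopping set `{y | V(y) = g(y)}`. -/
def stoppingSet (𝒜 : Filtration ℕ mΩ) (P : E → Measure Ω) (ρ : ℝ≥0) (g : E → ℝ≥0)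
    (Y : ℕ → Ω → E) : Set E :=
  {y | value 𝒜 P ρ g Y y = g y}

/-- Under every `P_y`: `E_y sup_n ρ ^ n g(Y_n) < ∞`, and `ρ ^ n g(Y_n) → 0` almost surely. -/
def Opt (P : E → Measure Ω) (ρ : ℝ≥0) (g : E → ℝ≥0) (Y : ℕ → Ω → E) : Prop :=
  ∀ y, (∫⁻ ω, ⨆ n : ℕ, (ρ : ℝ≥0∞) ^ n * (g (Y n ω) : ℝ≥0∞) ∂(P y)) < ∞ ∧
    ∀ᵐ ω ∂(P y), Tendsto (fun n : ℕ => ρ ^ n * g (Y n ω)) atTop (𝓝 0)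

/-- `τ_y = inf {n > 0 : Y_n > y}`, with `inf ∅ = ∞`. -/
def upTime (Y : ℕ → Ω → E) (y : E) : Ω → WithTop ℕ :=
  hittingAfter Y {x : E | y < x} 1

/-- `φ(y) = E_y ρ ^ τ_y g(Y_{τ_y})`. -/
def phi (P : E → Measure Ω) (ρ : ℝ≥0) (g : E → ℝ≥0) (Y : ℕ → Ω → E) (y : E) : ℝ≥0∞ :=
  expReward P ρ g Y (upTime Y y) y

/-- The threshold `α* = inf {z : g(z) ≥ φ(z)}`, an infimum in the extended reals over the states
`z ∈ E`. -/
def alphaStar (P : E → Measure Ω) (ρ : ℝ≥0) (g : E → ℝ≥0) (Y : ℕ → Ω → E) : EReal :=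
  ⨅ (z : E) (_ : phi P ρ g Y z ≤ g z), ((z : ℝ) : EReal)

/-- `f(y) = (g(y) - φ(y)) / (1 - E_y ρ ^ τ_y)`. -/
def fStar (P : E → Measure Ω) (ρ : ℝ≥0) (g : E → ℝ≥0) (Y : ℕ → Ω → E) (y : E) : ℝ :=
  ((g y : ℝ) - (phi P ρ g Y y).toReal) / (1 - (expDiscount P ρ (upTime Y y) y).toReal)

end OneSidedStopping

end

open OneSidedStopping

/-! Let `step` be the discounted transition operator T, `ladder` the operator R with (Rh)(y) = E_y
ρ^{τ_y} h(Y_{τ_y}), and A the candidate stopping region: an upper set on which f is nonnegative and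
increasing, and off which f ≤ 0. Let U be the expected reward of stopping on entry into A. It
suffices that U is an excessive majorant of g, that is g ≤ U and TU ≤ U: optional stopping then
gives V ≤ U, and the entrance time attains U.

The definition of f reads g = f (1 - R1) + Rg. Since U = g on the upper set A, and from below A the
chain must pass a ladder time before entering A, this becomes U = F (1 - R1) + RU everywhere, where
F is f on A and 0 elsewhere, an increasing function (`hit_eq_add_ladder`).

Inequalities are obtained from a comparison principle (`eq_zero_of_le_ladder`): if d ≤ Rd and d is
dominated by the limit v of value iteration, then d = 0, because Rh ≤ Th for excessive h and hence d
≤ T^n v, which tends to 0. Applied to the positive part of g - U it gives the majorant property.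
Applied to U minus a level-m bound it yields `hit_le_of_level`, where monotonicity of F enters; one
transition from y = m turns this bound into TU ≤ U (`step_hit_le`). -/

namespace OneSidedStopping

/-! ### Discounted transition, entrance and value-iteration operators of a kernel -/

section Kernel

variable {X : Type*} [MeasurableSpace X] {κ : Kernel X X} {ρ : ℝ≥0} {A B : Set X}
  {h h' : X → ℝ≥0∞} {x : X}

/-- The discounted one-step transition operator. -/
noncomputable def step (κ : Kernel X X) (ρ : ℝ≥0) (h : X → ℝ≥0∞) (x : X) : ℝ≥0∞ :=
  ρ * ∫⁻ z, h z ∂(κ x)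

lemma measurable_step (hh : Measurable h) : Measurable (step κ ρ h) :=
  (hh.lintegral_kernel).const_mul _

lemma step_mono (hle : h ≤ h') : step κ ρ h ≤ step κ ρ h' := fun _ ↦ by
  unfold step; gcongr; exact hle _

lemma step_add (hh : Measurable h) : step κ ρ (h + h') = step κ ρ h + step κ ρ h' := by
  ext x
  simp [step, lintegral_add_left hh, mul_add]

lemma step_const_mul (hh : Measurable h) (c : ℝ≥0∞) :
    step κ ρ (fun x ↦ c * h x) x = c * step κ ρ h x := by
  simp only [step, lintegral_const_mul c hh]; ring

lemma step_iSup {u : ℕ → X → ℝ≥0∞} (hu : ∀ n, Measurable (u n)) (hmono : Monotone u) :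
    step κ ρ (fun x ↦ ⨆ n, u n x) x = ⨆ n, step κ ρ (u n) x := by
  simp only [step, lintegral_iSup hu hmono, ENNReal.mul_iSup]

lemma step_one [IsMarkovKernel κ] : step κ ρ 1 x = ρ := by simp [step]

open scoped Classical in
/-- The expected discounted reward `h` on entering `B`, within `n` steps. -/
noncomputable def hitWithin (κ : Kernel X X) (ρ : ℝ≥0) (B : Set X) (h : X → ℝ≥0∞) :
    ℕ → X → ℝ≥0∞
  | 0, x => if x ∈ B then h x else 0
  | n + 1, x => if x ∈ B then h x else step κ ρ (hitWithin κ ρ B h n) x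

/-- The expected discounted reward `h` on entering `B`. -/
noncomputable def hit (κ : Kernel X X) (ρ : ℝ≥0) (B : Set X) (h : X → ℝ≥0∞) (x : X) : ℝ≥0∞ :=
  ⨆ n, hitWithin κ ρ B h n x

lemma hitWithin_of_mem (n : ℕ) (hx : x ∈ B) : hitWithin κ ρ B h n x = h x := by
  cases n <;> simp [hitWithin, hx]

lemma hitWithin_succ_of_notMem (n : ℕ) (hx : x ∉ B) :
    hitWithin κ ρ B h (n + 1) x = step κ ρ (hitWithin κ ρ B h n) x := by
  simp [hitWithin, hx]

lemma measurable_hitWithin (hB : MeasurableSet B) (hh : Measurable h) (n : ℕ) :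
    Measurable (hitWithin κ ρ B h n) := by
  induction n with
  | zero => exact Measurable.ite hB hh measurable_const
  | succ n ih => exact Measurable.ite hB hh (measurable_step ih)

lemma measurable_hit (hB : MeasurableSet B) (hh : Measurable h) : Measurable (hit κ ρ B h) :=
  Measurable.iSup fun n ↦ measurable_hitWithin hB hh n

lemma monotone_hitWithin : Monotone (hitWithin κ ρ B h) := by
  refine monotone_nat_of_le_succ fun n ↦ ?_
  induction n with
  | zero =>
    intro x
    by_cases hx : x ∈ B <;> simp [hitWithin, hx]
  | succ n ih =>
    intro x
    by_cases hx : x ∈ B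
    · simp [hitWithin, hx]
    · simpa only [hitWithin_succ_of_notMem _ hx] using step_mono ih x

lemma hit_of_mem (hx : x ∈ B) : hit κ ρ B h x = h x := by
  simp [hit, hitWithin_of_mem _ hx]

lemma hit_of_notMem (hB : MeasurableSet B) (hh : Measurable h) (hx : x ∉ B) :
    hit κ ρ B h x = step κ ρ (hit κ ρ B h) x := by
  have h1 : step κ ρ (hit κ ρ B h) x = ⨆ n, step κ ρ (hitWithin κ ρ B h n) x :=
    step_iSup (measurable_hitWithin hB hh) monotone_hitWithin
  rw [h1, hit, ← Monotone.iSup_nat_add (f := fun n ↦ hitWithin κ ρ B h n x)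
    (fun _ _ hij ↦ monotone_hitWithin hij x) 1]
  simp only [hitWithin_succ_of_notMem _ hx]

/-- Minimality of the entrance reward: the finite-horizon iterates start below u, and each
transition preserves this. Most later upper bounds on `hit` come from a choice of u here. -/
lemma hit_le {u : X → ℝ≥0∞} (h1 : ∀ x ∈ B, h x ≤ u x) (h2 : ∀ x ∉ B, step κ ρ u x ≤ u x) :
    hit κ ρ B h ≤ u := by
  refine fun x ↦ iSup_le fun n ↦ ?_
  induction n generalizing x with
  | zero => by_cases hx : x ∈ B <;> simp [hitWithin, hx, h1]
  | succ n ih =>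
    by_cases hx : x ∈ B
    · simpa [hitWithin, hx] using h1 x hx
    · rw [hitWithin_succ_of_notMem _ hx]
      exact (step_mono ih x).trans (h2 x hx)

lemma hit_mono (hle : ∀ x ∈ B, h x ≤ h' x) : hit κ ρ B h ≤ hit κ ρ B h' := by
  refine fun x ↦ iSup_mono fun n ↦ ?_
  induction n generalizing x with
  | zero => by_cases hx : x ∈ B <;> simp [hitWithin, hx, hle]
  | succ n ih =>
    by_cases hx : x ∈ B
    · simpa [hitWithin, hx] using hle x hx
    · simpa only [hitWithin_succ_of_notMem _ hx] using step_mono ih x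

lemma hit_congr (heq : ∀ x ∈ B, h x = h' x) : hit κ ρ B h = hit κ ρ B h' :=
  le_antisymm (hit_mono fun x hx ↦ (heq x hx).le) (hit_mono fun x hx ↦ (heq x hx).ge)

lemma hit_add (hB : MeasurableSet B) (hh : Measurable h) :
    hit κ ρ B (h + h') = hit κ ρ B h + hit κ ρ B h' := by
  have key : ∀ n x, hitWithin κ ρ B (h + h') n x
      = hitWithin κ ρ B h n x + hitWithin κ ρ B h' n x := by
    intro n
    induction n with
    | zero => intro x; by_cases hx : x ∈ B <;> simp [hitWithin, hx]
    | succ n ih =>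
      intro x
      by_cases hx : x ∈ B
      · simp [hitWithin, hx]
      · simp only [hitWithin_succ_of_notMem _ hx]
        rw [show hitWithin κ ρ B (h + h') n = hitWithin κ ρ B h n + hitWithin κ ρ B h' n from
          funext ih, step_add (measurable_hitWithin hB hh n)]
        rfl
  ext x
  simp only [hit, Pi.add_apply, key]
  exact (ENNReal.iSup_add_iSup_of_monotone (fun _ _ hij ↦ monotone_hitWithin hij x)
    (fun _ _ hij ↦ monotone_hitWithin hij x)).symm

lemma hit_const_mul (hB : MeasurableSet B) (hh : Measurable h) (c : ℝ≥0∞) :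
    hit κ ρ B (fun x ↦ c * h x) = fun x ↦ c * hit κ ρ B h x := by
  have key : ∀ n x, hitWithin κ ρ B (fun x ↦ c * h x) n x = c * hitWithin κ ρ B h n x := by
    intro n
    induction n with
    | zero => intro x; by_cases hx : x ∈ B <;> simp [hitWithin, hx]
    | succ n ih =>
      intro x
      by_cases hx : x ∈ B
      · simp [hitWithin, hx]
      · simp only [hitWithin_succ_of_notMem _ hx]
        rw [show hitWithin κ ρ B (fun x ↦ c * h x) n = fun x ↦ c * hitWithin κ ρ B h n x from
          funext ih, step_const_mul (measurable_hitWithin hB hh n)]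
  ext x
  simp only [hit, key, ENNReal.mul_iSup]

/-- Entering a subset can be split at the entrance into the larger set. -/
lemma hit_hit (hAB : A ⊆ B) (hA : MeasurableSet A) (hB : MeasurableSet B) (hh : Measurable h) :
    hit κ ρ B (hit κ ρ A h) = hit κ ρ A h := by
  refine le_antisymm (hit_le (fun _ _ ↦ le_rfl) fun x hx ↦
    (hit_of_notMem hA hh (fun hxA ↦ hx (hAB hxA))).ge) (hit_le (fun x hx ↦ ?_) fun x hx ↦ ?_)
  · rw [hit_of_mem (hAB hx), hit_of_mem hx]
  -- On `B \ A` the outer operator has already stopped while the inner one still moves, so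
  -- minimality is used a second time, now for `B`.
  · by_cases hxB : x ∈ B
    · rw [hit_of_mem hxB, hit_of_notMem hA hh hx]
      refine step_mono (hit_le (fun _ _ ↦ le_rfl) fun z hz ↦ ?_) x
      exact (hit_of_notMem hA hh (fun hzA ↦ hz (hAB hzA))).ge
    · exact (hit_of_notMem hB (measurable_hit hA hh) hxB).ge

lemma hit_one_le_one [IsMarkovKernel κ] (hρ : ρ ≤ 1) : hit κ ρ B 1 ≤ 1 :=
  hit_le (fun _ _ ↦ le_rfl) fun x _ ↦ by
    rw [step_one]
    exact ENNReal.coe_le_one_iff.2 hρ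

/-- Value iteration: the optimal discounted reward `g` within `n` steps. -/
noncomputable def valueWithin (κ : Kernel X X) (ρ : ℝ≥0) (g : X → ℝ≥0∞) : ℕ → X → ℝ≥0∞
  | 0, x => g x
  | n + 1, x => max (g x) (step κ ρ (valueWithin κ ρ g n) x)

/-- The limit of the value iteration. -/
noncomputable def valueLim (κ : Kernel X X) (ρ : ℝ≥0) (g : X → ℝ≥0∞) (x : X) : ℝ≥0∞ :=
  ⨆ n, valueWithin κ ρ g n x

variable {g : X → ℝ≥0∞}

lemma measurable_valueWithin (hg : Measurable g) (n : ℕ) : Measurable (valueWithin κ ρ g n) := by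
  induction n with
  | zero => exact hg
  | succ n ih => exact hg.max (measurable_step ih)

lemma measurable_valueLim (hg : Measurable g) : Measurable (valueLim κ ρ g) :=
  Measurable.iSup fun n ↦ measurable_valueWithin hg n

lemma monotone_valueWithin : Monotone (valueWithin κ ρ g) := by
  refine monotone_nat_of_le_succ fun n ↦ ?_
  induction n with
  | zero => exact fun x ↦ le_max_left _ _
  | succ n ih => exact fun x ↦ max_le_max le_rfl (step_mono ih x)

lemma le_valueLim : g ≤ valueLim κ ρ g := fun x ↦ le_iSup (fun n ↦ valueWithin κ ρ g n x) 0

lemma step_valueLim_le (hg : Measurable g) : step κ ρ (valueLim κ ρ g) ≤ valueLim κ ρ g := by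
  intro x
  have h1 : step κ ρ (valueLim κ ρ g) x = ⨆ n, step κ ρ (valueWithin κ ρ g n) x :=
    step_iSup (measurable_valueWithin hg) monotone_valueWithin
  rw [h1]
  exact iSup_le fun n ↦ (le_max_right (g x) _).trans (le_iSup (fun n ↦ valueWithin κ ρ g n x) (n + 1))

lemma hit_le_valueLim (hg : Measurable g) : hit κ ρ B g ≤ valueLim κ ρ g :=
  hit_le (fun x _ ↦ le_valueLim x) fun x _ ↦ step_valueLim_le hg x

lemma step_iterate_succ_le (hh : step κ ρ h ≤ h) (n : ℕ) :
    step κ ρ ((step κ ρ)^[n] h) ≤ (step κ ρ)^[n] h := by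
  rw [← Function.iterate_succ_apply' (step κ ρ), Function.iterate_succ_apply]
  exact (Monotone.iterate (fun _ _ hle ↦ step_mono hle) n) hh

end Kernel

/-! ### The ladder operator and its comparison principle -/

section Ladder

variable {E : Set ℝ} {κ : Kernel E E} {ρ : ℝ≥0} {h h' u v : E → ℝ≥0∞} {x y : E}

/-- The expected discounted reward `h` at the first strictly positive time at which the chain
started at `y` exceeds `y`. -/
noncomputable def ladder (κ : Kernel E E) (ρ : ℝ≥0) (h : E → ℝ≥0∞) (y : E) : ℝ≥0∞ :=
  step κ ρ (hit κ ρ (Set.Ioi y) h) y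

lemma ladder_mono (hle : h ≤ h') : ladder κ ρ h ≤ ladder κ ρ h' :=
  fun y ↦ step_mono (hit_mono fun x _ ↦ hle x) y

lemma ladder_congr (heq : ∀ x, y < x → h x = h' x) : ladder κ ρ h y = ladder κ ρ h' y := by
  rw [ladder, ladder, hit_congr (B := Set.Ioi y) heq]

lemma ladder_add (hh : Measurable h) :
    ladder κ ρ (h + h') y = ladder κ ρ h y + ladder κ ρ h' y := by
  rw [ladder, hit_add measurableSet_Ioi hh, step_add (measurable_hit measurableSet_Ioi hh)]
  rfl

lemma ladder_const_mul (hh : Measurable h) (c : ℝ≥0∞) :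
    ladder κ ρ (fun x ↦ c * h x) y = c * ladder κ ρ h y := by
  rw [ladder, hit_const_mul measurableSet_Ioi hh,
    step_const_mul (measurable_hit measurableSet_Ioi hh), ladder]

/-- Subtraction is truncated, so additivity and u ≤ v + (u - v) give only this inequality; it needs
no finiteness, and it is the direction that comparison requires. -/
lemma ladder_sub_le (hv : Measurable v) :
    ladder κ ρ u y - ladder κ ρ v y ≤ ladder κ ρ (u - v) y := by
  rw [tsub_le_iff_left, ← ladder_add hv]
  exact ladder_mono (fun x ↦ le_add_tsub) y

/-- For an excessive h, continuing from time 1 until the chain exceeds y cannot increase the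
expected discounted value. -/
lemma ladder_le_step (hh : step κ ρ h ≤ h) : ladder κ ρ h ≤ step κ ρ h :=
  fun y ↦ step_mono (hit_le (fun _ _ ↦ le_rfl) fun x _ ↦ hh x) y

lemma ladder_one_le [IsMarkovKernel κ] (hρ : ρ ≤ 1) : ladder κ ρ 1 y ≤ ρ :=
  (step_mono (hit_one_le_one hρ) y).trans step_one.le

/-- Reaching a set above `y` can be split at the first ladder time. -/
lemma ladder_hit {A : Set E} (hA : MeasurableSet A) (hh : Measurable h)
    (hy : ∀ x ∈ A, y < x) : hit κ ρ A h y = ladder κ ρ (hit κ ρ A h) y := by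
  rw [ladder, hit_hit (B := Set.Ioi y) hy hA measurableSet_Ioi hh, hit_of_notMem hA hh fun h ↦ lt_irrefl y (hy y h)]

/-- A comparison principle: a function dominated by the value iteration and by its own ladder
average vanishes. -/
lemma eq_zero_of_le_ladder {g d : E → ℝ≥0∞} (hg : Measurable g)
    (hlim : ∀ y, Tendsto (fun n ↦ (step κ ρ)^[n] (valueLim κ ρ g) y) atTop (𝓝 0))
    (hd : d ≤ valueLim κ ρ g) (hd' : d ≤ ladder κ ρ d) : d = 0 := by
  have key : ∀ n, d ≤ (step κ ρ)^[n] (valueLim κ ρ g) := by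
    intro n
    induction n with
    | zero => exact hd
    | succ n ih =>
      rw [Function.iterate_succ_apply']
      exact hd'.trans ((ladder_mono ih).trans
        (ladder_le_step (step_iterate_succ_le (step_valueLim_le hg) n)))
  ext y
  exact le_antisymm (ge_of_tendsto' (hlim y) fun n ↦ key n y) zero_le

end Ladder

/-! ### Entrance into an upper set: majorant property and excessivity -/

section Core

variable {E : Set ℝ} {κ : Kernel E E} {ρ : ℝ≥0} {g F : E → ℝ≥0∞} {A : Set E}

/-- On A every ladder state is again in A, where the entrance reward is g, so the identity for g
carries over. Off A every state of A lies above y, so entrance can be split at the first ladder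
time. -/
lemma hit_eq_add_ladder (hg : Measurable g) (hA : MeasurableSet A) (hup : IsUpperSet A)
    (hF : ∀ y ∈ A, g y = F y * (1 - ladder κ ρ 1 y) + ladder κ ρ g y)
    (hF0 : ∀ y ∉ A, F y = 0) (y : E) :
    hit κ ρ A g y = F y * (1 - ladder κ ρ 1 y) + ladder κ ρ (hit κ ρ A g) y := by
  by_cases hy : y ∈ A
  · rw [hit_of_mem hy, hF y hy,
      ladder_congr (h := hit κ ρ A g) fun x hx ↦ hit_of_mem (hup hx.le hy)]
  · rw [hF0 y hy, zero_mul, zero_add]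
    exact ladder_hit hA hg fun x hx ↦ lt_of_not_ge fun hxy ↦ hy (hup hxy hx)

/-- With U the entrance reward and d = g - U truncated, d vanishes on A. Off A, g ≤ Rg and U = RU
give d ≤ Rd, so the comparison principle applies. -/
lemma le_hit_of_le_ladder (hg : Measurable g) (hA : MeasurableSet A) (hup : IsUpperSet A)
    (hlim : ∀ y, Tendsto (fun n ↦ (step κ ρ)^[n] (valueLim κ ρ g) y) atTop (𝓝 0))
    (hgA : ∀ y ∉ A, g y ≤ ladder κ ρ g y) : g ≤ hit κ ρ A g := by
  have hd : g - hit κ ρ A g = 0 := by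
    refine eq_zero_of_le_ladder (κ := κ) (ρ := ρ) hg hlim
      (fun y ↦ tsub_le_self.trans (le_valueLim y)) fun y ↦ ?_
    by_cases hy : y ∈ A
    · simp [hit_of_mem hy]
    · refine le_trans ?_ (ladder_sub_le (measurable_hit hA hg))
      have := ladder_hit (κ := κ) (ρ := ρ) hA hg
        fun x hx ↦ lt_of_not_ge fun hxy ↦ hy (hup hxy hx)
      rw [← this]
      exact tsub_le_tsub_right (hgA y hy) _
  exact fun y ↦ tsub_eq_zero_iff_le.1 (congrFun hd y)

/-- The source term F is bounded by the constant F(m) until the chain exceeds m; from then on U is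
kept. The factor 1 - p, with p the expected discount on passing m, is what the constant source
accumulates before that passage. -/
lemma hit_le_of_level [IsMarkovKernel κ] (hρ : ρ ≤ 1) (hg : Measurable g) (hA : MeasurableSet A)
    (hup : IsUpperSet A)
    (hlim : ∀ y, Tendsto (fun n ↦ (step κ ρ)^[n] (valueLim κ ρ g) y) atTop (𝓝 0))
    (hF : ∀ y ∈ A, g y = F y * (1 - ladder κ ρ 1 y) + ladder κ ρ g y)
    (hF0 : ∀ y ∉ A, F y = 0) (hFm : Monotone F) (m : E) :
    hit κ ρ A g ≤ fun x ↦ F m * (1 - hit κ ρ (Set.Ioi m) 1 x)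
      + hit κ ρ (Set.Ioi m) (hit κ ρ A g) x := by
  set U := hit κ ρ A g with hU
  set p := hit κ ρ (Set.Ioi m) 1 with hp
  set H := hit κ ρ (Set.Ioi m) U with hH
  set W : E → ℝ≥0∞ := fun x ↦ F m * (1 - p x) + H x with hW
  have hUm : Measurable U := measurable_hit hA hg
  have hpm : Measurable p := measurable_hit measurableSet_Ioi measurable_one
  have hHm : Measurable H := measurable_hit measurableSet_Ioi hUm
  have hqm : Measurable fun x ↦ 1 - p x := measurable_const.sub hpm
  have hWm : Measurable W := (hqm.const_mul _).add hHm
  have hp1 : p ≤ 1 := hit_one_le_one hρ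
  have hd : U - W = 0 := by
    refine eq_zero_of_le_ladder (κ := κ) (ρ := ρ) hg hlim
      (fun y ↦ tsub_le_self.trans (hit_le_valueLim hg y)) fun x ↦ ?_
    by_cases hx : m < x
    · have hHx : H x = U x := hit_of_mem hx
      have hUW : U x ≤ W x := hHx.ge.trans le_add_self
      exact (tsub_eq_zero_iff_le.2 hUW).le.trans zero_le
    · have hx' : ∀ z ∈ Set.Ioi m, x < z := fun z hz ↦ (not_lt.1 hx).trans_lt hz
      have hpR : p x = ladder κ ρ p x := ladder_hit measurableSet_Ioi measurable_one hx'
      have hHR : H x = ladder κ ρ H x := ladder_hit measurableSet_Ioi hUm hx'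
      have hone : ladder κ ρ 1 x = ladder κ ρ (fun x ↦ 1 - p x) x + ladder κ ρ p x := by
        rw [← ladder_add hqm]
        congr 1
        ext z
        exact (tsub_add_cancel_of_le (hp1 z)).symm
      have hle1 : ladder κ ρ 1 x ≤ 1 := (ladder_one_le hρ).trans (by exact_mod_cast hρ)
      -- For x ≤ m, W is a supersolution with source F(m) while U has source F(x) ≤ F(m).
      -- Subtracting removes the source and leaves U - W ≤ R(U - W).
      have hWR : F m * (1 - ladder κ ρ 1 x) + ladder κ ρ W x ≤ W x := by
        have h1 : ladder κ ρ W x = F m * ladder κ ρ (fun x ↦ 1 - p x) x + ladder κ ρ H x := by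
          rw [← ladder_const_mul hqm, ← ladder_add (hqm.const_mul _)]
          rfl
        have h2 : (1 - ladder κ ρ 1 x) + ladder κ ρ (fun x ↦ 1 - p x) x ≤ 1 - p x := by
          refine ENNReal.le_sub_of_add_le_right ((hp1 x).trans_lt ENNReal.one_lt_top).ne ?_
          rw [add_assoc, hpR, ← hone, tsub_add_cancel_of_le hle1]
        rw [h1, ← add_assoc, ← mul_add, ← hHR]
        simp only [hW]
        gcongr
      calc (U - W) x = U x - W x := rfl
        _ ≤ (F m * (1 - ladder κ ρ 1 x) + ladder κ ρ U x)
            - (F m * (1 - ladder κ ρ 1 x) + ladder κ ρ W x) := by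
          refine tsub_le_tsub ?_ hWR
          rw [hU, hit_eq_add_ladder hg hA hup hF hF0 x]
          gcongr
          exact hFm (not_lt.1 hx)
        _ ≤ ladder κ ρ U x - ladder κ ρ W x := add_tsub_add_le_tsub_left
        _ ≤ ladder κ ρ (U - W) x := ladder_sub_le hWm
  exact fun y ↦ tsub_eq_zero_iff_le.1 (congrFun hd y)

/-- Take the level m to be the starting point y and apply T: the term for U becomes exactly RU(y),
and T(1 - p)(y) + R1(y) = T1(y) = ρ ≤ 1 bounds the other by F(y)(1 - R1(y)). The sum is U(y). -/
lemma step_hit_le [IsMarkovKernel κ] (hρ : ρ ≤ 1) (hg : Measurable g) (hA : MeasurableSet A) (hup : IsUpperSet A)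
    (hlim : ∀ y, Tendsto (fun n ↦ (step κ ρ)^[n] (valueLim κ ρ g) y) atTop (𝓝 0))
    (hF : ∀ y ∈ A, g y = F y * (1 - ladder κ ρ 1 y) + ladder κ ρ g y)
    (hF0 : ∀ y ∉ A, F y = 0) (hFm : Monotone F) :
    step κ ρ (hit κ ρ A g) ≤ hit κ ρ A g := by
  intro y
  have hpm : Measurable (hit κ ρ (Set.Ioi y) 1) := measurable_hit measurableSet_Ioi measurable_one
  have hqm : Measurable fun x ↦ 1 - hit κ ρ (Set.Ioi y) 1 x := measurable_const.sub hpm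
  refine (step_mono (hit_le_of_level hρ hg hA hup hlim hF hF0 hFm y) y).trans ?_
  have h1 := step_add (κ := κ) (ρ := ρ) (hqm.const_mul (F y))
    (h' := hit κ ρ (Set.Ioi y) (hit κ ρ A g))
  refine (congrFun h1 y).le.trans ?_
  rw [Pi.add_apply, step_const_mul hqm, hit_eq_add_ladder hg hA hup hF hF0 y]
  refine add_le_add (mul_le_mul_right ?_ _) le_rfl
  have hle1 : ladder κ ρ 1 y ≤ ρ := ladder_one_le hρ
  refine ENNReal.le_sub_of_add_le_right
    (hle1.trans_lt ENNReal.coe_lt_top).ne ?_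
  rw [ladder, ← Pi.add_apply (step κ ρ _), ← step_add hqm]
  refine (step_mono (h' := 1) (fun z ↦ ?_) y).trans (step_one.le.trans (by exact_mod_cast hρ))
  exact (tsub_add_cancel_of_le (hit_one_le_one hρ z)).le

end Core

end OneSidedStopping

namespace OneSidedStopping

/-! ### From the Markov property to the operators, and decay of the value iteration -/

section Markov

variable {Ω : Type*} {mΩ : MeasurableSpace Ω} {E : Set ℝ} {κ : Kernel E E}
  {𝒜 : Filtration ℕ mΩ} {Y : ℕ → Ω → E} {P : E → Measure Ω} {ρ : ℝ≥0} {h g U : E → ℝ≥0∞}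
  {B : Set E} {C : Set Ω} {τ : Ω → WithTop ℕ}

lemma IsMarkovFamily.measurable (hY : IsMarkovFamily κ 𝒜 Y P) (n : ℕ) : Measurable (Y n) :=
  (hY.adapted n).mono (𝒜.le n) le_rfl

lemma IsMarkovFamily.setLIntegral_succ [IsMarkovKernel κ] (hY : IsMarkovFamily κ 𝒜 Y P) (y : E)
    (n : ℕ) (hC : MeasurableSet[𝒜 n] C) (hh : Measurable h) :
    ∫⁻ ω in C, h (Y (n + 1) ω) ∂(P y) = ∫⁻ ω in C, ∫⁻ z, h z ∂(κ (Y n ω)) ∂(P y) := by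
  have := hY.isProbabilityMeasure y
  have hYm := hY.measurable
  have hC' : MeasurableSet C := 𝒜.le n _ hC
  -- Testing the conditional probabilities on C identifies the law of the next state restricted to
  -- C; arbitrary nonnegative h then follows by integration against this law.
  have hlaw : ((P y).restrict C).map (Y (n + 1)) = (((P y).restrict C).map (Y n)).bind κ := by
    ext B hB
    have hκB : Measurable fun ω ↦ κ (Y n ω) B := (κ.measurable_coe hB).comp (hYm n)
    rw [Measure.map_apply (hYm _) hB, Measure.bind_apply hB κ.aemeasurable,
      lintegral_map (κ.measurable_coe hB) (hYm n),
      Measure.restrict_apply (hYm _ hB)]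
    have h1 : ∫ ω in C, ((P y)⟦Y (n + 1) ⁻¹' B | 𝒜 n⟧) ω ∂(P y)
        = ∫ ω in C, (Y (n + 1) ⁻¹' B).indicator (fun _ ↦ (1 : ℝ)) ω ∂(P y) :=
      setIntegral_condExp (𝒜.le n) ((integrable_const 1).indicator (hYm _ hB)) hC
    rw [integral_indicator (hYm _ hB), integral_const, smul_eq_mul, mul_one,
      integral_congr_ae (ae_restrict_of_ae (hY.markov y n B hB))] at h1
    have h2 : ∫ ω in C, (κ (Y n ω)).real B ∂(P y)
        = (∫⁻ ω in C, κ (Y n ω) B ∂(P y)).toReal :=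
      integral_toReal hκB.aemeasurable (ae_of_all _ fun ω ↦ measure_lt_top _ _)
    rw [h2, Measure.real, Measure.restrict_apply_univ,
      Measure.restrict_apply (hYm _ hB)] at h1
    refine ((ENNReal.toReal_eq_toReal_iff' ?_ (measure_ne_top _ _)).1 h1).symm
    refine ((lintegral_mono fun ω ↦ prob_le_one).trans_lt ?_).ne
    simp
  calc ∫⁻ ω in C, h (Y (n + 1) ω) ∂(P y)
      = ∫⁻ z, h z ∂(((P y).restrict C).map (Y (n + 1))) := (lintegral_map hh (hYm _)).symm
    _ = ∫⁻ x, ∫⁻ z, h z ∂(κ x) ∂(((P y).restrict C).map (Y n)) := by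
      rw [hlaw, Measure.lintegral_bind κ.aemeasurable hh.aemeasurable]
    _ = ∫⁻ ω in C, ∫⁻ z, h z ∂(κ (Y n ω)) ∂(P y) := lintegral_map hh.lintegral_kernel (hYm n)

lemma IsMarkovFamily.setLIntegral_discount_succ [IsMarkovKernel κ]
    (hY : IsMarkovFamily κ 𝒜 Y P) (y : E) (n : ℕ) (hC : MeasurableSet[𝒜 n] C)
    (hh : Measurable h) :
    ∫⁻ ω in C, (ρ : ℝ≥0∞) ^ (n + 1) * h (Y (n + 1) ω) ∂(P y)
      = ∫⁻ ω in C, (ρ : ℝ≥0∞) ^ n * step κ ρ h (Y n ω) ∂(P y) := by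
  have hYm := hY.measurable
  have h1 : Measurable fun ω ↦ ∫⁻ z, h z ∂(κ (Y n ω)) := hh.lintegral_kernel.comp (hYm n)
  have h2 : Measurable fun ω ↦ h (Y (n + 1) ω) := hh.comp (hYm _)
  simp only [step]
  rw [lintegral_const_mul _ h2, hY.setLIntegral_succ y n hC hh,
    lintegral_const_mul _ (h1.const_mul _), lintegral_const_mul _ h1, pow_succ, mul_assoc]

lemma IsMarkovFamily.lintegral_start (hY : IsMarkovFamily κ 𝒜 Y P) (y : E) :
    ∫⁻ ω, h (Y 0 ω) ∂(P y) = h y := by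
  have := hY.isProbabilityMeasure y
  rw [lintegral_congr_ae (g := fun _ ↦ h y) ((hY.start y).mono fun ω hω ↦ by simp only [hω])]
  simp

lemma IsMarkovFamily.lintegral_discount [IsMarkovKernel κ] (hY : IsMarkovFamily κ 𝒜 Y P) (y : E)
    (n : ℕ) (hh : Measurable h) :
    ∫⁻ ω, (ρ : ℝ≥0∞) ^ n * h (Y n ω) ∂(P y) = (step κ ρ)^[n] h y := by
  induction n generalizing h with
  | zero => simpa using hY.lintegral_start (h := h) y
  | succ n ih =>
    have h1 := hY.setLIntegral_discount_succ (ρ := ρ) y n MeasurableSet.univ hh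
    simp only [Measure.restrict_univ] at h1
    rw [h1, ih (measurable_step hh), Function.iterate_succ_apply]

/-- The value iteration is dominated by the expected maximal reward. -/
lemma IsMarkovFamily.setLIntegral_valueWithin_le [IsMarkovKernel κ]
    (hY : IsMarkovFamily κ 𝒜 Y P) (y : E) (hg : Measurable g) (n k : ℕ)
    (hC : MeasurableSet[𝒜 k] C) :
    ∫⁻ ω in C, (ρ : ℝ≥0∞) ^ k * valueWithin κ ρ g n (Y k ω) ∂(P y)
      ≤ ∫⁻ ω in C, ⨆ j, (ρ : ℝ≥0∞) ^ (j + k) * g (Y (j + k) ω) ∂(P y) := by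
  have hnow : ∀ (k : ℕ) (C : Set Ω), ∫⁻ ω in C, (ρ : ℝ≥0∞) ^ k * g (Y k ω) ∂(P y)
      ≤ ∫⁻ ω in C, ⨆ j, (ρ : ℝ≥0∞) ^ (j + k) * g (Y (j + k) ω) ∂(P y) :=
    fun k C ↦ lintegral_mono fun ω ↦
      le_iSup_of_le (f := fun j ↦ (ρ : ℝ≥0∞) ^ (j + k) * g (Y (j + k) ω)) 0 (by simp)
  induction n generalizing k C with
  | zero => exact hnow k C
  | succ n ih =>
    -- D is the event of stopping at time k. The induction runs over all events of `𝒜 k` so that it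
    -- can be resumed on the continuation event `C \ D`.
    set D : Set Ω := Y k ⁻¹' {x | step κ ρ (valueWithin κ ρ g n) x ≤ g x} with hDdef
    have hD : MeasurableSet[𝒜 k] D :=
      hY.adapted k (measurableSet_le (measurable_step (measurable_valueWithin hg n)) hg)
    have hD' : MeasurableSet D := 𝒜.le k _ hD
    rw [← lintegral_inter_add_sdiff _ C hD', ← lintegral_inter_add_sdiff
      (fun ω ↦ ⨆ j, (ρ : ℝ≥0∞) ^ (j + k) * g (Y (j + k) ω)) C hD']
    refine add_le_add ?_ ?_
    · refine le_trans (le_of_eq ?_) (hnow k _)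
      refine setLIntegral_congr_fun ((𝒜.le k _ hC).inter hD') fun ω hω ↦ ?_
      have hω' : step κ ρ (valueWithin κ ρ g n) (Y k ω) ≤ g (Y k ω) := hω.2
      simp [valueWithin, max_eq_left hω']
    · have hCD : MeasurableSet[𝒜 k] (C \ D) := hC.diff hD
      calc ∫⁻ ω in C \ D, (ρ : ℝ≥0∞) ^ k * valueWithin κ ρ g (n + 1) (Y k ω) ∂(P y)
          = ∫⁻ ω in C \ D, (ρ : ℝ≥0∞) ^ k * step κ ρ (valueWithin κ ρ g n) (Y k ω) ∂(P y) := by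
            refine setLIntegral_congr_fun (𝒜.le k _ hCD) fun ω hω ↦ ?_
            have hω' : ¬ step κ ρ (valueWithin κ ρ g n) (Y k ω) ≤ g (Y k ω) := hω.2
            simp [valueWithin, max_eq_right (not_le.1 hω').le]
        _ = ∫⁻ ω in C \ D, (ρ : ℝ≥0∞) ^ (k + 1) * valueWithin κ ρ g n (Y (k + 1) ω) ∂(P y) :=
            (hY.setLIntegral_discount_succ y k hCD (measurable_valueWithin hg n)).symm
        _ ≤ ∫⁻ ω in C \ D, ⨆ j, (ρ : ℝ≥0∞) ^ (j + (k + 1)) * g (Y (j + (k + 1)) ω) ∂(P y) :=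
            ih (k + 1) (𝒜.mono k.le_succ _ hCD)
        _ ≤ _ := lintegral_mono fun ω ↦ iSup_le fun j ↦
            le_iSup_of_le (f := fun j ↦ (ρ : ℝ≥0∞) ^ (j + k) * g (Y (j + k) ω)) (j + 1)
              (by rw [show j + 1 + k = j + (k + 1) by ring])

lemma IsMarkovFamily.iterate_step_valueLim_le [IsMarkovKernel κ]
    (hY : IsMarkovFamily κ 𝒜 Y P) (y : E) (hg : Measurable g) (k : ℕ) :
    (step κ ρ)^[k] (valueLim κ ρ g) y
      ≤ ∫⁻ ω, ⨆ j, (ρ : ℝ≥0∞) ^ (j + k) * g (Y (j + k) ω) ∂(P y) := by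
  rw [← hY.lintegral_discount y k (measurable_valueLim hg)]
  have hm : ∀ n, Measurable fun ω ↦ (ρ : ℝ≥0∞) ^ k * valueWithin κ ρ g n (Y k ω) :=
    fun n ↦ ((measurable_valueWithin hg n).comp (hY.measurable k)).const_mul _
  simp only [valueLim, ENNReal.mul_iSup]
  rw [lintegral_iSup hm fun i j hij ω ↦ mul_le_mul_right (monotone_valueWithin hij _) _]
  exact iSup_le fun n ↦ by
    simpa using hY.setLIntegral_valueWithin_le (ρ := ρ) y hg n k MeasurableSet.univ

lemma IsMarkovFamily.valueLim_le [IsMarkovKernel κ] (hY : IsMarkovFamily κ 𝒜 Y P) (y : E)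
    (hg : Measurable g) :
    valueLim κ ρ g y ≤ ∫⁻ ω, ⨆ j : ℕ, (ρ : ℝ≥0∞) ^ j * g (Y j ω) ∂(P y) := by
  simpa using hY.iterate_step_valueLim_le (ρ := ρ) y hg 0

lemma tendsto_iSup_add_of_tendsto_zero {u : ℕ → ℝ≥0∞} (hu : Tendsto u atTop (𝓝 0)) :
    Tendsto (fun k ↦ ⨆ j, u (j + k)) atTop (𝓝 0) := by
  have := hu.limsup_eq
  rw [limsup_eq_iInf_iSup_of_nat'] at this
  rw [← this]
  exact tendsto_atTop_iInf fun k l hkl ↦ iSup_le fun j ↦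
    le_iSup_of_le (f := fun j ↦ u (j + k)) (j + (l - k)) (by rw [add_assoc, Nat.sub_add_cancel hkl])

/-- The k-th iterate is at most the expected supremum of the discounted rewards from time k on.
These suprema tend to 0 almost surely and are dominated by the integrable overall supremum. -/
lemma IsMarkovFamily.tendsto_iterate_step_valueLim [IsMarkovKernel κ]
    (hY : IsMarkovFamily κ 𝒜 Y P) (y : E) {g : E → ℝ≥0} (hg : Measurable g)
    (hOpt : Opt P ρ g Y) :
    Tendsto (fun n ↦ (step κ ρ)^[n] (valueLim κ ρ fun x ↦ g x) y) atTop (𝓝 0) := by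
  have hg' : Measurable fun x ↦ (g x : ℝ≥0∞) := hg.coe_nnreal_ennreal
  have hm : ∀ n, Measurable fun ω ↦ (ρ : ℝ≥0∞) ^ n * (g (Y n ω) : ℝ≥0∞) :=
    fun n ↦ (hg'.comp (hY.measurable n)).const_mul _
  refine tendsto_of_tendsto_of_tendsto_of_le_of_le tendsto_const_nhds ?_
    (fun n ↦ zero_le) (fun n ↦ hY.iterate_step_valueLim_le y hg' n)
  rw [← lintegral_zero (μ := P y)]
  refine tendsto_lintegral_of_dominated_convergence _ (fun k ↦ Measurable.iSup fun j ↦ hm _)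
    (fun k ↦ ae_of_all _ fun ω ↦ iSup_le fun j ↦
      le_iSup (fun n : ℕ ↦ (ρ : ℝ≥0∞) ^ n * (g (Y n ω) : ℝ≥0∞)) (j + k)) (hOpt y).1.ne ?_
  filter_upwards [(hOpt y).2] with ω hω
  refine tendsto_iSup_add_of_tendsto_zero
    (u := fun n ↦ (ρ : ℝ≥0∞) ^ n * (g (Y n ω) : ℝ≥0∞)) ?_
  have := ENNReal.tendsto_coe.2 hω
  simpa using this

end Markov

/-! ### Optional stopping, and entrance times as operators -/

section Stopping

variable {Ω : Type*} {mΩ : MeasurableSpace Ω} {E : Set ℝ} {κ : Kernel E E}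
  {𝒜 : Filtration ℕ mΩ} {Y : ℕ → Ω → E} {P : E → Measure Ω} {ρ : ℝ≥0} {g : E → ℝ≥0}
  {U : E → ℝ≥0∞} {B : Set E} {C : Set Ω} {τ : Ω → WithTop ℕ}

lemma reward_eq_tsum (ω : Ω) :
    reward ρ g Y τ ω
      = ∑' n : ℕ, {ω | τ ω = n}.indicator (fun ω ↦ (ρ : ℝ≥0∞) ^ n * (g (Y n ω) : ℝ≥0∞)) ω := by
  rcases hτ : τ ω with _ | m
  · have h0 : reward ρ g Y τ ω = 0 := by simp only [reward, hτ]
    rw [h0]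
    refine (ENNReal.tsum_eq_zero.2 fun n ↦ Set.indicator_of_notMem (fun hn ↦ ?_) _).symm
    exact WithTop.top_ne_coe (hτ.symm.trans hn)
  · rw [tsum_eq_single m]
    · rw [Set.indicator_of_mem (show ω ∈ {ω | τ ω = (m : WithTop ℕ)} from hτ)]
      simp only [reward, hτ]
    · intro n hn
      refine Set.indicator_of_notMem ?_ _
      intro hn'
      have : (m : WithTop ℕ) = n := hτ.symm.trans hn'
      exact hn (WithTop.coe_injective this).symm

lemma expReward_eq_tsum (hY : IsMarkovFamily κ 𝒜 Y P) (hg : Measurable g)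
    (hτ : IsStoppingTime 𝒜 τ) (y : E) :
    expReward P ρ g Y τ y
      = ∑' n : ℕ, ∫⁻ ω in {ω | τ ω = n}, (ρ : ℝ≥0∞) ^ n * (g (Y n ω) : ℝ≥0∞) ∂(P y) := by
  have hm : ∀ n : ℕ, MeasurableSet {ω | τ ω = n} := fun n ↦ 𝒜.le n _ (hτ.measurableSet_eq n)
  have hgm : ∀ n, Measurable fun ω ↦ (ρ : ℝ≥0∞) ^ n * (g (Y n ω) : ℝ≥0∞) :=
    fun n ↦ (hg.coe_nnreal_ennreal.comp (hY.measurable n)).const_mul _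
  unfold expReward
  simp_rw [reward_eq_tsum]
  rw [lintegral_tsum fun n ↦ ((hgm n).indicator (hm n)).aemeasurable]
  exact tsum_congr fun n ↦ lintegral_indicator (hm n) _

/-- Optional stopping for excessive majorants of the reward function. -/
lemma expReward_le_of_excessive [IsMarkovKernel κ] (hY : IsMarkovFamily κ 𝒜 Y P)
    (hg : Measurable g) (hU : Measurable U) (hgU : ∀ x, (g x : ℝ≥0∞) ≤ U x)
    (hstep : step κ ρ U ≤ U) (hτ : IsStoppingTime 𝒜 τ) (y : E) :
    expReward P ρ g Y τ y ≤ U y := by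
  have hgt : ∀ n : ℕ, MeasurableSet[𝒜 n] {ω | (n : WithTop ℕ) < τ ω} :=
    fun n ↦ hτ.measurableSet_gt n
  -- Reward collected before time N, plus U at time N on the paths not yet stopped, stays below
  -- U(y): passing to N + 1 uses g ≤ U where τ = N and TU ≤ U where τ > N.
  have key : ∀ N : ℕ, ∑ n ∈ Finset.range N,
      ∫⁻ ω in {ω | τ ω = n}, (ρ : ℝ≥0∞) ^ n * (g (Y n ω) : ℝ≥0∞) ∂(P y)
      + ∫⁻ ω in {ω | (N : WithTop ℕ) ≤ τ ω}, (ρ : ℝ≥0∞) ^ N * U (Y N ω) ∂(P y) ≤ U y := by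
    intro N
    induction N with
    | zero =>
      have : {ω | ((0 : ℕ) : WithTop ℕ) ≤ τ ω} = Set.univ := by ext; simp
      rw [this]
      simp [hY.lintegral_start (h := U) y]
    | succ N ih =>
      refine le_trans ?_ ih
      rw [Finset.sum_range_succ, add_assoc]
      gcongr
      have hsplit : {ω | (N : WithTop ℕ) ≤ τ ω}
          = {ω | τ ω = N} ∪ {ω | (N : WithTop ℕ) < τ ω} := by
        ext ω
        simp [le_iff_eq_or_lt, eq_comm]
      have hsucc : {ω | ((N + 1 : ℕ) : WithTop ℕ) ≤ τ ω} = {ω | (N : WithTop ℕ) < τ ω} := by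
        ext ω
        simp only [Set.mem_ofPred_eq, Nat.cast_add, Nat.cast_one]
        exact ENat.add_one_le_iff (ENat.natCast_ne_top N)
      have hdisj : Disjoint {ω | τ ω = N} {ω | (N : WithTop ℕ) < τ ω} :=
        Set.disjoint_left.2 fun ω h1 h2 ↦ (show (N : WithTop ℕ) < τ ω from h2).ne' h1
      rw [hsplit, hsucc, lintegral_union (𝒜.le N _ (hgt N)) hdisj]
      refine add_le_add (lintegral_mono fun ω ↦ mul_le_mul_right (hgU _) _) ?_
      rw [hY.setLIntegral_discount_succ y N (hgt N) hU]
      exact lintegral_mono fun ω ↦ mul_le_mul_right (hstep _) _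
  rw [expReward_eq_tsum hY hg hτ y, ENNReal.tsum_eq_iSup_nat]
  exact iSup_le fun N ↦ le_self_add.trans (key N)

open scoped Classical in
/-- The discounted reward on entering `B` after time `k`, within `n` steps. -/
noncomputable def hitReward (ρ : ℝ≥0) (g : E → ℝ≥0) (Y : ℕ → Ω → E) (B : Set E) :
    ℕ → ℕ → Ω → ℝ≥0∞
  | 0, k, ω => if Y k ω ∈ B then (ρ : ℝ≥0∞) ^ k * (g (Y k ω) : ℝ≥0∞) else 0
  | n + 1, k, ω => if Y k ω ∈ B then (ρ : ℝ≥0∞) ^ k * (g (Y k ω) : ℝ≥0∞)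
      else hitReward ρ g Y B n (k + 1) ω

lemma measurable_hitReward (hY : ∀ n, Measurable (Y n)) (hg : Measurable g)
    (hB : MeasurableSet B) (n k : ℕ) : Measurable (hitReward ρ g Y B n k) := by
  have hgm : ∀ n, Measurable fun ω ↦ (ρ : ℝ≥0∞) ^ n * (g (Y n ω) : ℝ≥0∞) :=
    fun n ↦ (hg.coe_nnreal_ennreal.comp (hY n)).const_mul _
  induction n generalizing k with
  | zero => exact Measurable.ite (hY k hB) (hgm k) measurable_const
  | succ n ih => exact Measurable.ite (hY k hB) (hgm k) (ih _)

lemma hitReward_of_forall_notMem {ω : Ω} (n k : ℕ) (hω : ∀ j, k ≤ j → Y j ω ∉ B) :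
    hitReward ρ g Y B n k ω = 0 := by
  induction n generalizing k with
  | zero => simp [hitReward, hω k le_rfl]
  | succ n ih => simp [hitReward, hω k le_rfl, ih (k + 1) fun j hj ↦ hω j (by omega)]

lemma hitReward_of_mem {ω : Ω} (n k m : ℕ) (hmem : Y (k + m) ω ∈ B)
    (hω : ∀ j < m, Y (k + j) ω ∉ B) :
    hitReward ρ g Y B n k ω
      = if m ≤ n then (ρ : ℝ≥0∞) ^ (k + m) * (g (Y (k + m) ω) : ℝ≥0∞) else 0 := by
  induction n generalizing k m with
  | zero =>
    rcases m with _ | m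
    · have h0 : Y k ω ∈ B := hmem
      simp [hitReward, h0]
    · have h0 : Y k ω ∉ B := hω 0 (by omega)
      simp [hitReward, h0]
  | succ n ih =>
    rcases m with _ | m
    · simp only [add_zero] at hmem
      simp [hitReward, hmem]
    · have h0 : Y k ω ∉ B := hω 0 (by omega)
      have hk : k + (m + 1) = k + 1 + m := by ring
      rw [hk] at hmem ⊢
      rw [hitReward, if_neg h0, ih (k + 1) m hmem fun j hj ↦ by
        have := hω (j + 1) (by omega)
        rwa [show k + (j + 1) = k + 1 + j by ring] at this]
      simp

lemma reward_hittingAfter (k : ℕ) (ω : Ω) :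
    reward ρ g Y (hittingAfter Y B k) ω = ⨆ n, hitReward ρ g Y B n k ω := by
  rcases hτ : hittingAfter Y B k ω with _ | m
  · have h0 : reward ρ g Y (hittingAfter Y B k) ω = 0 := by simp only [reward, hτ]
    rw [h0]
    simp [hitReward_of_forall_notMem _ k (hittingAfter_eq_top_iff.1 hτ)]
  · have hτ' : hittingAfter Y B k ω = (m : WithTop ℕ) := hτ
    have h0 : reward ρ g Y (hittingAfter Y B k) ω = (ρ : ℝ≥0∞) ^ m * (g (Y m ω) : ℝ≥0∞) := by
      simp only [reward, hτ]
    have hkm : k ≤ m := by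
      have := le_hittingAfter (u := Y) (s := B) (n := k) ω
      rw [hτ'] at this
      exact WithTop.coe_le_coe.1 this
    obtain ⟨l, rfl⟩ := Nat.exists_eq_add_of_le hkm
    have hmem : Y (k + l) ω ∈ B := by
      have := hittingAfter_mem_set_of_ne_top (u := Y) (s := B) (n := k) (ω := ω)
        (by rw [hτ']; exact WithTop.coe_ne_top)
      rwa [hτ'] at this
    have hnot : ∀ j < l, Y (k + j) ω ∉ B := fun j hj ↦
      notMem_of_lt_hittingAfter (n := k)
        (by rw [hτ']; exact WithTop.coe_lt_coe.2 (Nat.add_lt_add_left hj k)) (by omega)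
    rw [h0]
    simp only [hitReward_of_mem _ k l hmem hnot]
    refine le_antisymm (le_iSup_of_le l (by simp)) (iSup_le fun n ↦ ?_)
    split_ifs <;> simp

lemma setLIntegral_hitReward [IsMarkovKernel κ] (hY : IsMarkovFamily κ 𝒜 Y P)
    (hg : Measurable g) (hB : MeasurableSet B) (y : E) (n k : ℕ) (hC : MeasurableSet[𝒜 k] C) :
    ∫⁻ ω in C, hitReward ρ g Y B n k ω ∂(P y)
      = ∫⁻ ω in C, (ρ : ℝ≥0∞) ^ k * hitWithin κ ρ B (fun x ↦ g x) n (Y k ω) ∂(P y) := by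
  induction n generalizing k C with
  | zero =>
    refine lintegral_congr fun ω ↦ ?_
    by_cases hω : Y k ω ∈ B <;> simp [hitReward, hitWithin, hω]
  | succ n ih =>
    have hD : MeasurableSet[𝒜 k] (Y k ⁻¹' B) := hY.adapted k hB
    have hD' : MeasurableSet (Y k ⁻¹' B) := 𝒜.le k _ hD
    have hCD : MeasurableSet[𝒜 k] (C \ Y k ⁻¹' B) := hC.diff hD
    rw [← lintegral_inter_add_sdiff _ C hD', ← lintegral_inter_add_sdiff
      (fun ω ↦ (ρ : ℝ≥0∞) ^ k * hitWithin κ ρ B (fun x ↦ g x) (n + 1) (Y k ω)) C hD']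
    congr 1
    · refine setLIntegral_congr_fun ((𝒜.le k _ hC).inter hD') fun ω hω ↦ ?_
      have hω' : Y k ω ∈ B := hω.2
      simp [hitReward, hitWithin, hω']
    · calc ∫⁻ ω in C \ Y k ⁻¹' B, hitReward ρ g Y B (n + 1) k ω ∂(P y)
          = ∫⁻ ω in C \ Y k ⁻¹' B, hitReward ρ g Y B n (k + 1) ω ∂(P y) := by
            refine setLIntegral_congr_fun (𝒜.le k _ hCD) fun ω hω ↦ ?_
            have hω' : Y k ω ∉ B := hω.2
            simp [hitReward, hω']
        _ = ∫⁻ ω in C \ Y k ⁻¹' B, (ρ : ℝ≥0∞) ^ (k + 1)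
              * hitWithin κ ρ B (fun x ↦ g x) n (Y (k + 1) ω) ∂(P y) :=
            ih (k + 1) (𝒜.mono k.le_succ _ hCD)
        _ = ∫⁻ ω in C \ Y k ⁻¹' B, (ρ : ℝ≥0∞) ^ k
              * step κ ρ (hitWithin κ ρ B (fun x ↦ g x) n) (Y k ω) ∂(P y) :=
            hY.setLIntegral_discount_succ y k hCD
              (measurable_hitWithin hB hg.coe_nnreal_ennreal n)
        _ = _ := by
            refine setLIntegral_congr_fun (𝒜.le k _ hCD) fun ω hω ↦ ?_
            have hω' : Y k ω ∉ B := hω.2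
            simp only [hitWithin_succ_of_notMem _ hω']

lemma expReward_hittingAfter [IsMarkovKernel κ] (hY : IsMarkovFamily κ 𝒜 Y P)
    (hg : Measurable g) (hB : MeasurableSet B) (y : E) (k : ℕ) :
    expReward P ρ g Y (hittingAfter Y B k) y
      = (step κ ρ)^[k] (hit κ ρ B fun x ↦ g x) y := by
  have hg' : Measurable fun x ↦ (g x : ℝ≥0∞) := hg.coe_nnreal_ennreal
  rw [← hY.lintegral_discount y k (measurable_hit hB hg')]
  simp only [expReward, reward_hittingAfter, hit, ENNReal.mul_iSup]
  have hmono : Monotone fun n ↦ hitReward ρ g Y B n k := by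
    intro i j hij ω
    by_cases hex : ∃ m, Y (k + m) ω ∈ B
    · classical
      have h1 := fun n ↦ hitReward_of_mem (ρ := ρ) (g := g) n k (Nat.find hex)
        (Nat.find_spec hex) fun l hl ↦ Nat.find_min hex hl
      simp only [h1]
      split_ifs <;> first | omega | simp
    · have h1 := fun n ↦ hitReward_of_forall_notMem (ρ := ρ) (g := g) (Y := Y) (B := B) n k
        (ω := ω) fun l hl hmem ↦ hex ⟨l - k, by rwa [Nat.add_sub_cancel' hl]⟩
      simp [h1]
  have hm : ∀ n, Measurable fun ω ↦
      (ρ : ℝ≥0∞) ^ k * hitWithin κ ρ B (fun x ↦ (g x : ℝ≥0∞)) n (Y k ω) :=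
    fun n ↦ ((measurable_hitWithin hB hg' n).comp (hY.measurable k)).const_mul _
  rw [lintegral_iSup (fun n ↦ measurable_hitReward hY.measurable hg hB n k) hmono,
    lintegral_iSup hm fun i j hij ω ↦ mul_le_mul_right (monotone_hitWithin hij _) _]
  refine iSup_congr fun n ↦ ?_
  simpa using setLIntegral_hitReward (ρ := ρ) hY hg hB y n k MeasurableSet.univ

/-- Searching from time 1 instead of time 0 accounts for the single `step` in front of `hit` in
`ladder`. -/
lemma phi_eq_ladder [IsMarkovKernel κ] (hY : IsMarkovFamily κ 𝒜 Y P) (hg : Measurable g)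
    (y : E) : phi P ρ g Y y = ladder κ ρ (fun x ↦ g x) y :=
  expReward_hittingAfter hY hg measurableSet_Ioi y 1

lemma discount_eq_reward : (fun ω ↦ discount ρ (τ ω)) = reward ρ 1 Y τ := by
  ext ω
  rcases hτ : τ ω with _ | m
  · simp only [discount, reward, hτ]
  · simp only [discount, reward, hτ]
    simp

lemma expDiscount_eq_ladder [IsMarkovKernel κ] (hY : IsMarkovFamily κ 𝒜 Y P) (y : E) :
    expDiscount P ρ (upTime Y y) y = ladder κ ρ 1 y := by
  rw [expDiscount, discount_eq_reward (Y := Y)]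
  have h1 := expReward_hittingAfter (ρ := ρ) (g := 1) hY measurable_one
    (measurableSet_Ioi (a := y)) y 1
  have h2 : (fun x : E ↦ (((1 : E → ℝ≥0) x : ℝ≥0) : ℝ≥0∞)) = 1 := by ext; simp
  rwa [h2] at h1

/-- For ρ < 1 the bound R1 ≤ ρ suffices. For ρ = 1 the expected discount is the probability that the
ladder time is finite. -/
lemma ladder_one_lt_one [IsMarkovKernel κ] (hY : IsMarkovFamily κ 𝒜 Y P) (hρ1 : ρ ≤ 1)
    (hinf : ρ = 1 → ∀ y, 0 < P y {ω | upTime Y y ω = ⊤}) (y : E) : ladder κ ρ 1 y < 1 := by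
  rcases hρ1.lt_or_eq with hρ | rfl
  · exact (ladder_one_le hρ1).trans_lt (by exact_mod_cast hρ)
  · have := hY.isProbabilityMeasure y
    have hτ : IsStoppingTime 𝒜 (upTime Y y) :=
      Adapted.isStoppingTime_hittingAfter hY.adapted measurableSet_Ioi
    have hm : MeasurableSet {ω | upTime Y y ω = ⊤} := by
      have : {ω | upTime Y y ω = ⊤} = ⋂ n : ℕ, {ω | upTime Y y ω ≤ n}ᶜ := by
        ext ω
        simp [WithTop.eq_top_iff_forall_gt]
      rw [this]
      exact MeasurableSet.iInter fun n ↦ (𝒜.le n _ (hτ.measurableSet_le n)).compl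
    rw [← expDiscount_eq_ladder hY y, expDiscount]
    have h1 : ∀ ω, discount 1 (upTime Y y ω)
        = {ω | upTime Y y ω = ⊤}ᶜ.indicator (fun _ ↦ (1 : ℝ≥0∞)) ω := by
      intro ω
      rcases hω : upTime Y y ω with _ | m
      · have hmem : ω ∉ {ω | upTime Y y ω = ⊤}ᶜ := fun hn ↦ hn hω
        rw [Set.indicator_of_notMem hmem]
        rfl
      · rw [Set.indicator_of_mem (by
          simp only [Set.mem_compl_iff, Set.mem_ofPred_eq, hω]
          exact WithTop.coe_ne_top)]
        simp [discount]
    simp only [h1]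
    rw [lintegral_indicator_const hm.compl, one_mul, prob_compl_eq_one_sub hm]
    exact ENNReal.sub_lt_self ENNReal.one_ne_top one_ne_zero (hinf rfl y).ne'

end Stopping

end OneSidedStopping

namespace OneSidedStopping

/-! ### The sign of f and optimality of threshold times -/

section Threshold

variable {Ω : Type*} {mΩ : MeasurableSpace Ω} {E : Set ℝ} {κ : Kernel E E} [IsMarkovKernel κ]
  {𝒜 : Filtration ℕ mΩ} {Y : ℕ → Ω → E} {P : E → Measure Ω} {ρ : ℝ≥0} {g : E → ℝ≥0} {A : Set E}
  {y : E}

omit [IsMarkovKernel κ] in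
lemma coe_le_value (hY : IsMarkovFamily κ 𝒜 Y P) (y : E) :
    (g y : ℝ≥0∞) ≤ value 𝒜 P ρ g Y y := by
  have h0 : expReward P ρ g Y (fun _ ↦ ((0 : ℕ) : WithTop ℕ)) y = g y := by
    have h1 : ∀ ω, reward ρ g Y (fun _ ↦ ((0 : ℕ) : WithTop ℕ)) ω = g (Y 0 ω) :=
      fun ω ↦ by simp [reward]
    simp only [expReward, h1]
    exact hY.lintegral_start (h := fun x ↦ (g x : ℝ≥0∞)) y
  rw [← h0]
  exact le_iSup₂ (f := fun τ (_ : IsStoppingTime 𝒜 τ) ↦ expReward P ρ g Y τ y) _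
    (isStoppingTime_const 𝒜 0)

lemma ladder_lt_top (hY : IsMarkovFamily κ 𝒜 Y P) (hg : Measurable g) (hOpt : Opt P ρ g Y)
    (y : E) : ladder κ ρ (fun x ↦ g x) y < ∞ := by
  have hg' : Measurable fun x ↦ (g x : ℝ≥0∞) := hg.coe_nnreal_ennreal
  calc ladder κ ρ (fun x ↦ g x) y
      ≤ ladder κ ρ (valueLim κ ρ fun x ↦ g x) y := ladder_mono le_valueLim y
    _ ≤ step κ ρ (valueLim κ ρ fun x ↦ g x) y := ladder_le_step (step_valueLim_le hg') y
    _ ≤ valueLim κ ρ (fun x ↦ g x) y := step_valueLim_le hg' y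
    _ ≤ _ := hY.valueLim_le y hg'
    _ < ∞ := (hOpt y).1

lemma one_sub_expDiscount_pos (hY : IsMarkovFamily κ 𝒜 Y P) (hρ1 : ρ ≤ 1)
    (hinf : ρ = 1 → ∀ y, 0 < P y {ω | upTime Y y ω = ⊤}) (y : E) :
    0 < 1 - (expDiscount P ρ (upTime Y y) y).toReal := by
  have h1 := ladder_one_lt_one hY hρ1 hinf y
  rw [expDiscount_eq_ladder hY, sub_pos]
  simpa using (ENNReal.toReal_lt_toReal h1.ne_top ENNReal.one_ne_top).2 h1

/-- The denominator of f is positive and φ is finite, so f has the sign of g - φ. -/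
lemma fStar_nonneg_iff (hY : IsMarkovFamily κ 𝒜 Y P) (hg : Measurable g) (hOpt : Opt P ρ g Y)
    (hρ1 : ρ ≤ 1) (hinf : ρ = 1 → ∀ y, 0 < P y {ω | upTime Y y ω = ⊤}) :
    0 ≤ fStar P ρ g Y y ↔ phi P ρ g Y y ≤ g y := by
  have hφ : phi P ρ g Y y ≠ ∞ := by
    rw [phi_eq_ladder hY hg]
    exact (ladder_lt_top hY hg hOpt y).ne
  rw [fStar, le_div_iff₀ (one_sub_expDiscount_pos hY hρ1 hinf y), zero_mul, sub_nonneg,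
    ← ENNReal.coe_toReal, ENNReal.toReal_le_toReal hφ ENNReal.coe_ne_top]

lemma fStar_nonpos_iff (hY : IsMarkovFamily κ 𝒜 Y P) (hg : Measurable g) (hOpt : Opt P ρ g Y)
    (hρ1 : ρ ≤ 1) (hinf : ρ = 1 → ∀ y, 0 < P y {ω | upTime Y y ω = ⊤}) :
    fStar P ρ g Y y ≤ 0 ↔ g y ≤ phi P ρ g Y y := by
  have hφ : phi P ρ g Y y ≠ ∞ := by
    rw [phi_eq_ladder hY hg]
    exact (ladder_lt_top hY hg hOpt y).ne
  rw [fStar, div_le_iff₀ (one_sub_expDiscount_pos hY hρ1 hinf y), zero_mul, sub_nonpos,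
    ← ENNReal.coe_toReal, ENNReal.toReal_le_toReal ENNReal.coe_ne_top hφ]

/-- The definition of f solved for g; f ≥ 0 means φ ≤ g, which makes the truncated subtraction
exact. -/
lemma eq_fStar_mul_add_ladder (hY : IsMarkovFamily κ 𝒜 Y P) (hg : Measurable g)
    (hOpt : Opt P ρ g Y) (hρ1 : ρ ≤ 1)
    (hinf : ρ = 1 → ∀ y, 0 < P y {ω | upTime Y y ω = ⊤}) (hf : 0 ≤ fStar P ρ g Y y) :
    (g y : ℝ≥0∞) = ENNReal.ofReal (fStar P ρ g Y y) * (1 - ladder κ ρ 1 y)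
      + ladder κ ρ (fun x ↦ g x) y := by
  have hpos := one_sub_expDiscount_pos hY hρ1 hinf y
  have hφ := (ladder_lt_top hY hg hOpt y).ne
  have hle := ladder_one_lt_one hY hρ1 hinf y
  have h1 : 1 - ladder κ ρ 1 y
      = ENNReal.ofReal (1 - (expDiscount P ρ (upTime Y y) y).toReal) := by
    rw [expDiscount_eq_ladder hY, ENNReal.ofReal_sub _ ENNReal.toReal_nonneg,
      ENNReal.ofReal_toReal hle.ne_top, ENNReal.ofReal_one]
  rw [h1, ← ENNReal.ofReal_mul hf, fStar, div_mul_cancel₀ _ hpos.ne',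
    ENNReal.ofReal_sub _ ENNReal.toReal_nonneg, phi_eq_ladder hY hg, ENNReal.ofReal_toReal hφ,
    ENNReal.ofReal_coe_nnreal, ← phi_eq_ladder hY hg,
    tsub_add_cancel_of_le ((fStar_nonneg_iff hY hg hOpt hρ1 hinf).1 hf)]

/-- If `f` is nonnegative and increasing on an upper set and nonpositive outside of it, then the
entrance time into this set is optimal. -/
theorem isOptimal_hittingAfter_of_isUpperSet (hY : IsMarkovFamily κ 𝒜 Y P) (hg : Measurable g)
    (hOpt : Opt P ρ g Y) (hρ1 : ρ ≤ 1)
    (hinf : ρ = 1 → ∀ y, 0 < P y {ω | upTime Y y ω = ⊤})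
    (hA : MeasurableSet A) (hup : IsUpperSet A) (hmono : MonotoneOn (fStar P ρ g Y) A)
    (hpos : ∀ y ∈ A, 0 ≤ fStar P ρ g Y y) (hneg : ∀ y ∉ A, fStar P ρ g Y y ≤ 0) :
    IsOptimal 𝒜 P ρ g Y (hittingAfter Y A 0) ∧
      value 𝒜 P ρ g Y = hit κ ρ A fun x ↦ g x := by
  classical
  have hg' : Measurable fun x ↦ (g x : ℝ≥0∞) := hg.coe_nnreal_ennreal
  have hlim := fun y ↦ hY.tendsto_iterate_step_valueLim y hg hOpt
  have hτ : IsStoppingTime 𝒜 (hittingAfter Y A 0) :=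
    Adapted.isStoppingTime_hittingAfter hY.adapted hA
  -- Cutting f off to 0 outside A makes it increasing on all of E, since f ≥ 0 on A.
  set F : E → ℝ≥0∞ := fun y ↦ if y ∈ A then ENNReal.ofReal (fStar P ρ g Y y) else 0 with hFdef
  have hF0 : ∀ y ∉ A, F y = 0 := fun y hy ↦ if_neg hy
  have hF : ∀ y ∈ A, (g y : ℝ≥0∞) = F y * (1 - ladder κ ρ 1 y) + ladder κ ρ (fun x ↦ g x) y := by
    intro y hy
    simp only [hFdef, if_pos hy]
    exact eq_fStar_mul_add_ladder hY hg hOpt hρ1 hinf (hpos y hy)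
  have hFm : Monotone F := by
    intro x y hxy
    by_cases hx : x ∈ A
    · simp only [hFdef, if_pos hx, if_pos (hup hxy hx)]
      exact ENNReal.ofReal_le_ofReal (hmono hx (hup hxy hx) hxy)
    · exact (hF0 x hx).le.trans zero_le
  have hgA : ∀ y ∉ A, (g y : ℝ≥0∞) ≤ ladder κ ρ (fun x ↦ g x) y := by
    intro y hy
    rw [← phi_eq_ladder hY hg]
    exact (fStar_nonpos_iff hY hg hOpt hρ1 hinf).1 (hneg y hy)
  have hstep := step_hit_le hρ1 hg' hA hup hlim hF hF0 hFm
  have hle := le_hit_of_le_ladder hg' hA hup hlim hgA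
  have hexp : ∀ y, expReward P ρ g Y (hittingAfter Y A 0) y = hit κ ρ A (fun x ↦ g x) y :=
    fun y ↦ expReward_hittingAfter hY hg hA y 0
  have hval : value 𝒜 P ρ g Y = hit κ ρ A fun x ↦ g x := by
    ext y
    refine le_antisymm (iSup₂_le fun τ hτ' ↦ expReward_le_of_excessive hY hg
      (measurable_hit hA hg') hle hstep hτ' y) ?_
    rw [← hexp y]
    exact le_iSup₂ (f := fun τ (_ : IsStoppingTime 𝒜 τ) ↦ expReward P ρ g Y τ y) _ hτ
  exact ⟨⟨hτ, fun y ↦ by rw [hval, hexp]⟩, hval⟩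

/-- Some z < y with φ(z) ≤ g(z) witnesses the infimum; there f(z) ≥ 0, and monotonicity carries the
sign from z to y. -/
lemma fStar_nonneg_of_alphaStar_lt (hY : IsMarkovFamily κ 𝒜 Y P) (hg : Measurable g)
    (hOpt : Opt P ρ g Y) (hρ1 : ρ ≤ 1)
    (hinf : ρ = 1 → ∀ y, 0 < P y {ω | upTime Y y ω = ⊤})
    (hM1 : MonotoneOn (fStar P ρ g Y) {y : E | alphaStar P ρ g Y ≤ ((y : ℝ) : EReal)})
    (hy : alphaStar P ρ g Y < ((y : ℝ) : EReal)) : 0 ≤ fStar P ρ g Y y := by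
  obtain ⟨z, hz, hzy⟩ : ∃ z : E, phi P ρ g Y z ≤ g z ∧ ((z : ℝ) : EReal) < ((y : ℝ) : EReal) := by
    simpa only [alphaStar, iInf_lt_iff, exists_prop] using hy
  have hαz : alphaStar P ρ g Y ≤ ((z : ℝ) : EReal) := iInf₂_le z hz
  exact ((fStar_nonneg_iff hY hg hOpt hρ1 hinf).2 hz).trans
    (hM1 hαz hy.le (Subtype.coe_le_coe.1 (EReal.coe_lt_coe_iff.1 hzy).le))

lemma fStar_neg_of_lt_alphaStar (hY : IsMarkovFamily κ 𝒜 Y P) (hg : Measurable g)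
    (hOpt : Opt P ρ g Y) (hρ1 : ρ ≤ 1)
    (hinf : ρ = 1 → ∀ y, 0 < P y {ω | upTime Y y ω = ⊤})
    (hy : ((y : ℝ) : EReal) < alphaStar P ρ g Y) : fStar P ρ g Y y < 0 := by
  by_contra hf
  exact hy.not_ge (iInf₂_le y ((fStar_nonneg_iff hY hg hOpt hρ1 hinf).1 (not_lt.1 hf)))

end Threshold

end OneSidedStopping

/-! ### The theorem: the sign of f at the threshold decides to which side it belongs -/

theorem mainTheorem1 {Ω : Type*} {mΩ : MeasurableSpace Ω} (E : Set ℝ)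
    (κ : Kernel E E) [IsMarkovKernel κ]
    (𝒜 : Filtration ℕ mΩ) (Y : ℕ → Ω → E) (P : E → Measure Ω)
    (hY : IsMarkovFamily κ 𝒜 Y P)
    (ρ : ℝ≥0) (hρ0 : 0 < ρ) (hρ1 : ρ ≤ 1)
    (g : E → ℝ≥0) (hg : Measurable g)
    (hOpt : Opt P ρ g Y)
    (hinf : ρ = 1 → ∀ y, 0 < P y {ω | upTime Y y ω = ⊤})
    (hM1 : MonotoneOn (fStar P ρ g Y) {y : E | alphaStar P ρ g Y ≤ ((y : ℝ) : EReal)}) :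
    ((∀ a : E, ((a : ℝ) : EReal) = alphaStar P ρ g Y → 0 ≤ fStar P ρ g Y a) →
      IsOptimal 𝒜 P ρ g Y
        (hittingAfter Y {x : E | alphaStar P ρ g Y ≤ ((x : ℝ) : EReal)} 0) ∧
      stoppingSet 𝒜 P ρ g Y = {x : E | alphaStar P ρ g Y ≤ ((x : ℝ) : EReal)}) ∧
    ((∀ a : E, ((a : ℝ) : EReal) = alphaStar P ρ g Y → fStar P ρ g Y a ≤ 0) →
      IsOptimal 𝒜 P ρ g Y
        (hittingAfter Y {x : E | alphaStar P ρ g Y < ((x : ℝ) : EReal)} 0)) := by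
  have hemb : Measurable fun x : E ↦ ((x : ℝ) : EReal) :=
    measurable_coe_real_ereal.comp measurable_subtype_coe
  have hlt : ∀ y : E, alphaStar P ρ g Y < ((y : ℝ) : EReal) → 0 ≤ fStar P ρ g Y y :=
    fun y hy ↦ fStar_nonneg_of_alphaStar_lt hY hg hOpt hρ1 hinf hM1 hy
  have hgt : ∀ y : E, ((y : ℝ) : EReal) < alphaStar P ρ g Y → fStar P ρ g Y y < 0 :=
    fun y hy ↦ fStar_neg_of_lt_alphaStar hY hg hOpt hρ1 hinf hy
  constructor
  · intro hα
    have hup : IsUpperSet {x : E | alphaStar P ρ g Y ≤ ((x : ℝ) : EReal)} :=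
      fun x y hxy hx ↦ le_trans hx (EReal.coe_le_coe_iff.2 hxy)
    have hA : MeasurableSet {x : E | alphaStar P ρ g Y ≤ ((x : ℝ) : EReal)} :=
      measurableSet_le measurable_const hemb
    have hpos : ∀ y ∈ {x : E | alphaStar P ρ g Y ≤ ((x : ℝ) : EReal)}, 0 ≤ fStar P ρ g Y y := by
      intro y hy
      rcases (show alphaStar P ρ g Y ≤ ((y : ℝ) : EReal) from hy).eq_or_lt with h | h
      · exact hα y h.symm
      · exact hlt y h
    obtain ⟨hopt, hval⟩ := isOptimal_hittingAfter_of_isUpperSet hY hg hOpt hρ1 hinf hA hup hM1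
      hpos fun y hy ↦ (hgt y (not_le.1 hy)).le
    refine ⟨hopt, Set.ext fun y ↦ ?_⟩
    change value 𝒜 P ρ g Y y = g y ↔ _
    rw [hval]
    refine ⟨fun heq ↦ ?_, fun hy ↦ hit_of_mem hy⟩
    by_contra hy
    have hg' : Measurable fun x ↦ (g x : ℝ≥0∞) := hg.coe_nnreal_ennreal
    have hle : ∀ x, (g x : ℝ≥0∞)
        ≤ hit κ ρ {x : E | alphaStar P ρ g Y ≤ ((x : ℝ) : EReal)} (fun x ↦ g x) x :=
      fun x ↦ (coe_le_value hY x).trans_eq (congrFun hval x)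
    -- If V(y) = g(y) with y below the threshold, then g(y) = U(y) = RU(y) ≥ Rg(y) = φ(y),
    -- contradicting f(y) < 0.
    have hnot := (fStar_nonneg_iff hY hg hOpt hρ1 hinf).not.1 (hgt y (not_le.1 hy)).not_ge
    refine hnot ?_
    rw [phi_eq_ladder hY hg, ← heq, ladder_hit hA hg'
      fun x hx ↦ lt_of_not_ge fun hxy ↦ hy (hup hxy hx)]
    exact ladder_mono hle y
  · intro hα
    have hup : IsUpperSet {x : E | alphaStar P ρ g Y < ((x : ℝ) : EReal)} :=
      fun x y hxy hx ↦ lt_of_lt_of_le hx (EReal.coe_le_coe_iff.2 hxy)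
    have hA : MeasurableSet {x : E | alphaStar P ρ g Y < ((x : ℝ) : EReal)} :=
      measurableSet_lt measurable_const hemb
    refine (isOptimal_hittingAfter_of_isUpperSet hY hg hOpt hρ1 hinf hA hup
      (hM1.mono fun y (hy : alphaStar P ρ g Y < _) ↦ hy.le) hlt fun y hy ↦ ?_).1
    have hy' : ¬ alphaStar P ρ g Y < ((y : ℝ) : EReal) := hy
    rcases (not_lt.1 hy').eq_or_lt with h | h
    · exact hα y h
    · exact (hgt y h).le
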